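/- Let $n\ge 1$, let $(M,g)$ be a smooth $(n+1)$-dimensional Lorentzian manifold of signature $(-,+,\dots,+)$ with Levi-Civita connection $\nabla$, and let $f:M\to\mathbb R$ be a spacetime convex function: $f$ is smooth, its Hessian $\nabla\nabla f$ has Lorentzian signature at every point, and there is a constant $c>0$ such that $\nabla\nabla f(V,V)\ge c\,g(V,V)$ for every tangent vector $V$. Let $\Sigma\subset M$ be a smoothly embedded $n$-dimensional spacelike hypersurface, i.e. the induced metric $h$ is positive definite, and let $D$ be the Levi-Civita connection of $h$. For a unit timelike normal $t$ of $\Sigma$ ($g(t,t)=-1$) let $K(X,Y)=g(t,\nabla_XY)$ be the second fundamental form of $\Sigma$ with respect to $t$. Then: (1) At every point of $\Sigma$, for each choice of unit normal $t$ there, $$\nabla_i\nabla_j f = D_iD_j f + K_{ij}\,\partial_t f ,\qquad \partial_t f = t^\mu\partial_\mu f ,$$ where $i,j$ are directions tangent to $\Sigma$ and $D_iD_jf$ is the Hessian of $f|_\Sigma$ with respect to $h$. (2) If $\Sigma$ is maximal, i.e. $h^{ij}K_{ij}=0$ everywhere on $\Sigma$, then $f|_\Sigma$ is smooth and strictly subharmonic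 with respect to $h$: $h^{ij}D_iD_jf>0$ everywhere on $\Sigma$. -/

import Mathlib

set_option maxSynthPendingDepth 3

open scoped Manifold ContDiff

namespace Spacetime

noncomputable section

/-! ### Bilinear forms -/

/-- A bilinear form on an `(n+1)`-dimensional space has Lorentzian signature `(-,+,…,+)`:
in some basis it is `diag(-1, 1, …, 1)`. -/
def IsLorentzForm (n : ℕ) {V : Type*} [AddCommGroup V] [Module ℝ V] [TopologicalSpace V]
    [IsTopologicalAddGroup V] [ContinuousConstSMul ℝ V] (B : V →L[ℝ] V →L[ℝ] ℝ) : Prop :=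
  ∃ b : Module.Basis (Fin (n + 1)) ℝ V,
    ∀ i j, B (b i) (b j) = if i = j then (if i = 0 then -1 else 1) else 0

/-- The trace `h^{ij} B_{ij}` of `B` with respect to the nondegenerate form `h`: the trace of the
endomorphism `h⁻¹ ∘ B`. -/
def traceWith {E : Type*} [NormedAddCommGroup E] [NormedSpace ℝ E]
    (h B : E →L[ℝ] E →L[ℝ] ℝ) : ℝ :=
  LinearMap.trace ℝ E (h.inverse ∘L B : E →L[ℝ] E)

/-! ### The Levi-Civita connection in a coordinate domain

`G : E → E →L E →L ℝ` is a metric in coordinates, `y` a point of the coordinate domain. -/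

section Coordinates

variable {E : Type*} [NormedAddCommGroup E] [NormedSpace ℝ E]

/-- Christoffel symbols of the first kind,
`Γ(u,v;w) = ½ (∂_u G(v,w) + ∂_v G(u,w) - ∂_w G(u,v))`. -/
def christoffelFirst (G : E → E →L[ℝ] E →L[ℝ] ℝ) (y : E) : E →L[ℝ] E →L[ℝ] E →L[ℝ] ℝ :=
  let D : E →L[ℝ] E →L[ℝ] E →L[ℝ] ℝ := fderiv ℝ G y
  let T : (E →L[ℝ] E →L[ℝ] ℝ) →L[ℝ] (E →L[ℝ] E →L[ℝ] ℝ) :=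
    (ContinuousLinearMap.flipₗᵢ ℝ E E ℝ).toContinuousLinearEquiv
  let D' : E →L[ℝ] E →L[ℝ] E →L[ℝ] ℝ := T ∘L D.flip
  (1 / 2 : ℝ) • (D + D.flip - D')

theorem christoffelFirst_apply (G : E → E →L[ℝ] E →L[ℝ] ℝ) (y u v w : E) :
    christoffelFirst G y u v w =
      1 / 2 * (fderiv ℝ G y u v w + fderiv ℝ G y v u w - fderiv ℝ G y w u v) := rfl

/-- Christoffel symbols of the second kind: `G(Γ(u,v), w) = Γ(u,v;w)` for all `w`. -/
def christoffel (G : E → E →L[ℝ] E →L[ℝ] ℝ) (y : E) : E →L[ℝ] E →L[ℝ] E :=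
  (ContinuousLinearMap.compL ℝ E (E →L[ℝ] ℝ) E (G y).inverse) ∘L christoffelFirst G y

theorem christoffel_apply (G : E → E →L[ℝ] E →L[ℝ] ℝ) (y u v : E) :
    christoffel G y u v = (G y).inverse (christoffelFirst G y u v) := rfl

/-- The Hessian in coordinates, `∂_u ∂_v φ - Γ(u,v) φ`. -/
def coordHessian (G : E → E →L[ℝ] E →L[ℝ] ℝ) (φ : E → ℝ) (y : E) : E →L[ℝ] E →L[ℝ] ℝ :=
  fderiv ℝ (fderiv ℝ φ) y - (ContinuousLinearMap.compL ℝ E E ℝ (fderiv ℝ φ y)) ∘L christoffel G y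

theorem coordHessian_apply (G : E → E →L[ℝ] E →L[ℝ] ℝ) (φ : E → ℝ) (y u v : E) :
    coordHessian G φ y u v =
      fderiv ℝ (fderiv ℝ φ) y u v - fderiv ℝ φ y (christoffel G y u v) := rfl

end Coordinates

/-! ### Hessian and Laplacian on a manifold

Mathlib's tangent space at `x` is the model space `E`, identified through the preferred chart
at `x`; hence the components at `x` of a tensor in that chart are a tensor on `TangentSpace _ x`. -/

section Manifold

variable {E : Type*} [NormedAddCommGroup E] [NormedSpace ℝ E]
  {M : Type*} [TopologicalSpace M] [ChartedSpace E M]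

/-- The components of a field `g` of bilinear forms in the chart at `x`: at the coordinate point
`y`, the form `(u, v) ↦ g (dφ⁻¹ u, dφ⁻¹ v)` where `φ` is the chart. -/
def coordMetric (g : ∀ x : M, TangentSpace 𝓘(ℝ, E) x →L[ℝ] TangentSpace 𝓘(ℝ, E) x →L[ℝ] ℝ)
    (x : M) (y : E) : E →L[ℝ] E →L[ℝ] ℝ :=
  let B : E →L[ℝ] E →L[ℝ] ℝ := g ((extChartAt 𝓘(ℝ, E) x).symm y)
  let A : E →L[ℝ] E := mfderiv 𝓘(ℝ, E) 𝓘(ℝ, E) (extChartAt 𝓘(ℝ, E) x).symm y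
  B.bilinearComp A A

/-- The Hessian `∇∇f` at `x`, for the Levi-Civita connection `∇` of `g`. -/
def hessian (g : ∀ x : M, TangentSpace 𝓘(ℝ, E) x →L[ℝ] TangentSpace 𝓘(ℝ, E) x →L[ℝ] ℝ)
    (f : M → ℝ) (x : M) :
    TangentSpace 𝓘(ℝ, E) x →L[ℝ] TangentSpace 𝓘(ℝ, E) x →L[ℝ] ℝ :=
  coordHessian (E := E) (coordMetric g x) (f ∘ (extChartAt 𝓘(ℝ, E) x).symm) (extChartAt 𝓘(ℝ, E) x x)

/-- The derivative `t^μ ∂_μ f` of `f` at `x` in the direction `t`. -/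
def directionalDeriv (f : M → ℝ) (x : M) (t : TangentSpace 𝓘(ℝ, E) x) : ℝ :=
  mfderiv 𝓘(ℝ, E) 𝓘(ℝ, ℝ) f x t

/-- The Laplacian `g^{ij} ∇_i ∇_j f`. -/
def laplacian (g : ∀ x : M, TangentSpace 𝓘(ℝ, E) x →L[ℝ] TangentSpace 𝓘(ℝ, E) x →L[ℝ] ℝ)
    (f : M → ℝ) (x : M) : ℝ :=
  traceWith (E := E) (g x) (hessian g f x)

/-- `f` is smooth and strictly subharmonic: its Laplacian is everywhere positive. -/
def IsStrictlySubharmonic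
    (g : ∀ x : M, TangentSpace 𝓘(ℝ, E) x →L[ℝ] TangentSpace 𝓘(ℝ, E) x →L[ℝ] ℝ)
    (f : M → ℝ) : Prop :=
  ContMDiff 𝓘(ℝ, E) 𝓘(ℝ, ℝ) ∞ f ∧ ∀ x, 0 < laplacian g f x

end Manifold

/-! ### Spacetimes -/

/-- A smooth Lorentzian metric on an `(n+1)`-dimensional manifold. -/
structure LorentzMetric (n : ℕ) (M : Type*) [TopologicalSpace M]
    [ChartedSpace (EuclideanSpace ℝ (Fin (n + 1))) M] [IsManifold (𝓡 (n + 1)) ∞ M] where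
  /-- The form on each tangent space. -/
  form (x : M) : TangentSpace (𝓡 (n + 1)) x →L[ℝ] TangentSpace (𝓡 (n + 1)) x →L[ℝ] ℝ
  symm (x : M) (v w : TangentSpace (𝓡 (n + 1)) x) : form x v w = form x w v
  lorentzian (x : M) : IsLorentzForm n (form x)
  contMDiff : ContMDiff (𝓡 (n + 1))
    ((𝓡 (n + 1)).prod 𝓘(ℝ, EuclideanSpace ℝ (Fin (n + 1)) →L[ℝ]
      EuclideanSpace ℝ (Fin (n + 1)) →L[ℝ] ℝ)) ∞
    (fun x ↦ Bundle.TotalSpace.mk' (EuclideanSpace ℝ (Fin (n + 1)) →L[ℝ]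
      EuclideanSpace ℝ (Fin (n + 1)) →L[ℝ] ℝ) x (form x))

section Hypersurface

variable {n : ℕ} {M : Type*} [TopologicalSpace M]
  [ChartedSpace (EuclideanSpace ℝ (Fin (n + 1))) M] [IsManifold (𝓡 (n + 1)) ∞ M]
  {S : Type*} [TopologicalSpace S] [ChartedSpace (EuclideanSpace ℝ (Fin n)) S]

/-- Spacetime convex functions: the Hessian has Lorentzian signature everywhere, and
`∇∇f ≥ c g` for a constant `c > 0`. -/
def IsSpacetimeConvex (g : LorentzMetric n M) (f : M → ℝ) : Prop :=
  ContMDiff (𝓡 (n + 1)) 𝓘(ℝ, ℝ) ∞ f ∧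
  (∀ x, IsLorentzForm n (hessian g.form f x)) ∧
  ∃ c : ℝ, 0 < c ∧ ∀ (x : M) (v : TangentSpace (𝓡 (n + 1)) x),
    c * g.form x v v ≤ hessian g.form f x v v

/-- The first fundamental form (induced metric) `h = ι^* g`. -/
def inducedMetric (g : LorentzMetric n M) (ι : S → M) (p : S) :
    TangentSpace (𝓡 n) p →L[ℝ] TangentSpace (𝓡 n) p →L[ℝ] ℝ :=
  let B : EuclideanSpace ℝ (Fin (n + 1)) →L[ℝ] EuclideanSpace ℝ (Fin (n + 1)) →L[ℝ] ℝ :=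
    g.form (ι p)
  let A : EuclideanSpace ℝ (Fin n) →L[ℝ] EuclideanSpace ℝ (Fin (n + 1)) :=
    mfderiv (𝓡 n) (𝓡 (n + 1)) ι p
  B.bilinearComp A A

/-- The embedded hypersurface `ι : S → M` is spacelike: the induced metric is positive definite. -/
structure IsSpacelikeHypersurface (g : LorentzMetric n M) (ι : S → M) : Prop where
  isSmoothEmbedding : Manifold.IsSmoothEmbedding (𝓡 n) (𝓡 (n + 1)) ∞ ι
  spacelike (p : S) (u : TangentSpace (𝓡 n) p) : u ≠ 0 → 0 < inducedMetric g ι p u u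

/-- `t` is a unit timelike vector at `ι p`, normal to the hypersurface. -/
def IsUnitNormal (g : LorentzMetric n M) (ι : S → M) (p : S)
    (t : TangentSpace (𝓡 (n + 1)) (ι p)) : Prop :=
  g.form (ι p) t t = -1 ∧
  ∀ u : TangentSpace (𝓡 n) p, g.form (ι p) t (mfderiv (𝓡 n) (𝓡 (n + 1)) ι p u) = 0

/-- The vector `∇_u (dι v)` at `ι p`, where `v` is extended to a vector field on `S` with constant
components in the chart at `p`, and `∇` is the Levi-Civita connection of `g`: in coordinates,
`∂_u ∂_v ι + Γ(dι u, dι v)`. Only the part tangent to the hypersurface depends on the extension. -/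
def covDerivAlong (g : LorentzMetric n M) (ι : S → M) (p : S) :
    EuclideanSpace ℝ (Fin n) →L[ℝ] EuclideanSpace ℝ (Fin n) →L[ℝ]
      EuclideanSpace ℝ (Fin (n + 1)) :=
  let A : EuclideanSpace ℝ (Fin n) →L[ℝ] EuclideanSpace ℝ (Fin (n + 1)) :=
    mfderiv (𝓡 n) (𝓡 (n + 1)) ι p
  fderiv ℝ (fderiv ℝ (writtenInExtChartAt (𝓡 n) (𝓡 (n + 1)) p ι)) (extChartAt (𝓡 n) p p) +
    (christoffel (coordMetric g.form (ι p)) (extChartAt (𝓡 (n + 1)) (ι p) (ι p))).bilinearComp A A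

/-- The second fundamental form with respect to the unit normal `t`,
`K(u, v) = g(t, ∇_u v) = -g(∇_u t, v)`. -/
def secondFundamentalForm (g : LorentzMetric n M) (ι : S → M) (p : S)
    (t : TangentSpace (𝓡 (n + 1)) (ι p)) :
    TangentSpace (𝓡 n) p →L[ℝ] TangentSpace (𝓡 n) p →L[ℝ] ℝ :=
  let τ : EuclideanSpace ℝ (Fin (n + 1)) →L[ℝ] ℝ := g.form (ι p) t
  (ContinuousLinearMap.compL ℝ (EuclideanSpace ℝ (Fin n)) (EuclideanSpace ℝ (Fin (n + 1))) ℝ τ) ∘L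
    covDerivAlong g ι p

theorem secondFundamentalForm_apply (g : LorentzMetric n M) (ι : S → M) (p : S)
    (t : TangentSpace (𝓡 (n + 1)) (ι p)) (u v : TangentSpace (𝓡 n) p) :
    secondFundamentalForm g ι p t u v = g.form (ι p) t (covDerivAlong g ι p u v) := rfl

/-- The hypersurface is maximal: `h^{ij} K_{ij} = 0` everywhere (this does not depend on the choice
of the unit normal, which is unique up to sign). -/
def IsMaximal (g : LorentzMetric n M) (ι : S → M) : Prop :=
  ∀ (p : S) (t : TangentSpace (𝓡 (n + 1)) (ι p)), IsUnitNormal g ι p t →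
    traceWith (E := EuclideanSpace ℝ (Fin n)) (inducedMetric g ι p)
      (secondFundamentalForm g ι p t) = 0

end Hypersurface

end

end Spacetime

open Spacetime

/-! In charts, let `F` represent the embedding, `A` be its derivative at the point, `G` the ambient
metric and `H` the induced one. Put `W = D²F(u,v) + Γ_G(Au,Av)`, the ambient covariant derivative
along the hypersurface. Differentiating `H = F^*G` gives `G(W, Aw) = Γ_H(u,v;w)`
(`christoffelFirst_pullback`), so the tangential part of `W` is `A Γ_H(u,v)`. Since `G(t,t) = -1`,
its normal part is `-G(t,W) t = -K(u,v) t`. Applying `dφ` to this decomposition and using the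
second-order chain rule for `φ ∘ F` gives the Hessian identity (`coordHessian_pullback`). The
Christoffel terms need no special coordinates. `coordMetric_inducedMetric` shows that, in charts,
the induced metric is indeed `F^*G`. For a maximal hypersurface, tracing the identity with `h`
removes the `K` term. What remains is the trace of the ambient Hessian restricted to tangent
vectors, which is at least `c h`, hence positive definite, and so has positive trace
(`traceWith_pos`). -/

namespace Spacetime
open Topology

/-! ### Gauss formula and Hessian identity in coordinates. -/

section Coordinates

variable {E E' : Type*} [NormedAddCommGroup E] [NormedSpace ℝ E]
  [NormedAddCommGroup E'] [NormedSpace ℝ E']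

/-- Derivative of the components of a pulled back metric. -/
theorem fderiv_pullback_apply {G : E' → E' →L[ℝ] E' →L[ℝ] ℝ} {H : E → E →L[ℝ] E →L[ℝ] ℝ}
    {F : E → E'} {y : E} (hG : DifferentiableAt ℝ G (F y)) (hF : ContDiffAt ℝ 2 F y)
    (hH : H =ᶠ[𝓝 y] fun z ↦ (G (F z)).bilinearComp (fderiv ℝ F z) (fderiv ℝ F z))
    (hHd : DifferentiableAt ℝ H y) (u v w : E) :
    fderiv ℝ H y u v w =
      fderiv ℝ G (F y) (fderiv ℝ F y u) (fderiv ℝ F y v) (fderiv ℝ F y w) +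
        G (F y) (fderiv ℝ (fderiv ℝ F) y u v) (fderiv ℝ F y w) +
        G (F y) (fderiv ℝ F y v) (fderiv ℝ (fderiv ℝ F) y u w) := by
  have hF1 : DifferentiableAt ℝ F y := hF.differentiableAt (by norm_num)
  have hF2 : DifferentiableAt ℝ (fderiv ℝ F) y :=
    (hF.fderiv_right (m := 1) (by norm_num)).differentiableAt (by norm_num)
  have hGF : HasFDerivAt (fun z ↦ G (F z)) ((fderiv ℝ G (F y)).comp (fderiv ℝ F y)) y :=
    hG.hasFDerivAt.comp y hF1.hasFDerivAt
  have hA (x : E) : HasFDerivAt (fun z ↦ fderiv ℝ F z x) ((fderiv ℝ (fderiv ℝ F) y).flip x) y := by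
    simpa using hF2.hasFDerivAt.clm_apply (hasFDerivAt_const x y)
  -- With `v` and `w` frozen, the product rule is applied to a scalar function.
  have h1 := (hGF.clm_apply (hA v)).clm_apply (hA w)
  have h2 : HasFDerivAt (fun z ↦ H z v w) (((fderiv ℝ H y).flip v).flip w) y := by
    simpa using (hHd.hasFDerivAt.clm_apply (hasFDerivAt_const v y)).clm_apply (hasFDerivAt_const w y)
  have h3 : (fun z ↦ H z v w) =ᶠ[𝓝 y] fun z ↦ G (F z) (fderiv ℝ F z v) (fderiv ℝ F z w) := by
    filter_upwards [hH] with z hz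
    rw [hz]; rfl
  have h4 := congrArg (fun L ↦ L u) ((h2.congr_of_eventuallyEq h3.symm).unique h1)
  simp at h4
  linarith

/-- Differentiability of the pullback of a metric. -/
theorem differentiableAt_pullback {G : E' → E' →L[ℝ] E' →L[ℝ] ℝ} {F : E → E'} {y : E}
    (hG : DifferentiableAt ℝ G (F y)) (hF : ContDiffAt ℝ 2 F y) :
    DifferentiableAt ℝ (fun z ↦ (G (F z)).bilinearComp (fderiv ℝ F z) (fderiv ℝ F z)) y := by
  have hF1 : DifferentiableAt ℝ F y := hF.differentiableAt (by norm_num)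
  have hF2 : DifferentiableAt ℝ (fderiv ℝ F) y :=
    (hF.fderiv_right (m := 1) (by norm_num)).differentiableAt (by norm_num)
  have hGF : DifferentiableAt ℝ (fun z ↦ G (F z)) y := hG.comp y hF1
  -- `bilinearComp` unfolds to compose, flip, compose, flip, and flipping is a continuous linear
  -- equivalence.
  have h1 : DifferentiableAt ℝ (fun z ↦ ((G (F z)).comp (fderiv ℝ F z)).flip) y :=
    (ContinuousLinearMap.flipₗᵢ ℝ E E' ℝ).toContinuousLinearEquiv.differentiableAt.comp y
      (hGF.clm_comp hF2)
  exact (ContinuousLinearMap.flipₗᵢ ℝ E E ℝ).toContinuousLinearEquiv.differentiableAt.comp y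
      (h1.clm_comp hF2)

/-- The Christoffel symbols of a pulled back metric: the Gauss formula in coordinates. -/
theorem christoffelFirst_pullback {G : E' → E' →L[ℝ] E' →L[ℝ] ℝ} {H : E → E →L[ℝ] E →L[ℝ] ℝ}
    {F : E → E'} {y : E} (hG : DifferentiableAt ℝ G (F y))
    (hsymm : ∀ v w, G (F y) v w = G (F y) w v) (hF : ContDiffAt ℝ 2 F y)
    (hH : H =ᶠ[𝓝 y] fun z ↦ (G (F z)).bilinearComp (fderiv ℝ F z) (fderiv ℝ F z)) (u v w : E) :
    christoffelFirst H y u v w =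
      christoffelFirst G (F y) (fderiv ℝ F y u) (fderiv ℝ F y v) (fderiv ℝ F y w) +
        G (F y) (fderiv ℝ (fderiv ℝ F) y u v) (fderiv ℝ F y w) := by
  have hHd : DifferentiableAt ℝ H y := (differentiableAt_pullback hG hF).congr_of_eventuallyEq hH
  have hs : IsSymmSndFDerivAt ℝ F y := hF.isSymmSndFDerivAt (by simp)
  simp only [christoffelFirst_apply, fderiv_pullback_apply hG hF hH hHd]
  -- By symmetry of `D²F` and of `G`, the terms containing `D²F(u,w)` and `D²F(v,w)` cancel, and
  -- `D²F(u,v)` occurs twice.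
  rw [hs v u, hs w u, hs w v, hsymm (fderiv ℝ F y v), hsymm (fderiv ℝ F y u)]
  ring

theorem map_christoffel {G : E → E →L[ℝ] E →L[ℝ] ℝ} {y : E} (hG : (G y).IsInvertible) (u v w : E) :
    G y (christoffel G y u v) w = christoffelFirst G y u v w := by
  rw [christoffel_apply, hG.self_apply_inverse]

/-- The relation between the Hessian and the Hessian of the restriction in coordinates, given a
unit timelike normal `t`. -/
theorem coordHessian_pullback {G : E' → E' →L[ℝ] E' →L[ℝ] ℝ} {H : E → E →L[ℝ] E →L[ℝ] ℝ}
    {F : E → E'} {φ : E' → ℝ} {ψ : E → ℝ} {y : E} (hG : DifferentiableAt ℝ G (F y))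
    (hsymm : ∀ v w, G (F y) v w = G (F y) w v) (hF : ContDiffAt ℝ 2 F y)
    (hφ : ContDiffAt ℝ 2 φ (F y)) (hψ : ψ =ᶠ[𝓝 y] φ ∘ F)
    (hH : H =ᶠ[𝓝 y] fun z ↦ (G (F z)).bilinearComp (fderiv ℝ F z) (fderiv ℝ F z))
    (hGi : (G (F y)).IsInvertible) (hHi : (H y).IsInvertible) {t : E'}
    (ht : G (F y) t t = -1) (htF : ∀ u, G (F y) t (fderiv ℝ F y u) = 0)
    (hspan : ∀ x, ∃ u : E, ∃ a : ℝ, x = fderiv ℝ F y u + a • t) (u v : E) :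
    coordHessian G φ (F y) (fderiv ℝ F y u) (fderiv ℝ F y v) =
      coordHessian H ψ y u v +
        G (F y) t (fderiv ℝ (fderiv ℝ F) y u v +
          christoffel G (F y) (fderiv ℝ F y u) (fderiv ℝ F y v)) * fderiv ℝ φ (F y) t := by
  have hF1 : ∀ᶠ z in 𝓝 y, DifferentiableAt ℝ F z :=
    (hF.eventually (by norm_num)).mono fun z hz ↦ hz.differentiableAt (by norm_num)
  have hF2 : DifferentiableAt ℝ (fderiv ℝ F) y :=
    (hF.fderiv_right (m := 1) (by norm_num)).differentiableAt (by norm_num)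
  have hφ1 : ∀ᶠ z in 𝓝 (F y), DifferentiableAt ℝ φ z :=
    (hφ.eventually (by norm_num)).mono fun z hz ↦ hz.differentiableAt (by norm_num)
  have hφ2 : DifferentiableAt ℝ (fderiv ℝ φ) (F y) :=
    (hφ.fderiv_right (m := 1) (by norm_num)).differentiableAt (by norm_num)
  have hψ1 : fderiv ℝ ψ =ᶠ[𝓝 y] fun z ↦ (fderiv ℝ φ (F z)).comp (fderiv ℝ F z) := by
    filter_upwards [hψ.eventuallyEq_nhds, hF1, hF.continuousAt.eventually hφ1] with z h1 h2 h3
    rw [h1.fderiv_eq, fderiv_comp z h3 h2]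
  have hψ2 : fderiv ℝ (fderiv ℝ ψ) y u v =
      fderiv ℝ (fderiv ℝ φ) (F y) (fderiv ℝ F y u) (fderiv ℝ F y v) +
        fderiv ℝ φ (F y) (fderiv ℝ (fderiv ℝ F) y u v) := by
    have h1 : HasFDerivAt (fun z ↦ fderiv ℝ φ (F z))
        ((fderiv ℝ (fderiv ℝ φ) (F y)).comp (fderiv ℝ F y)) y :=
      hφ2.hasFDerivAt.comp y hF1.self_of_nhds.hasFDerivAt
    rw [hψ1.fderiv_eq, (h1.clm_comp hF2.hasFDerivAt).fderiv]
    simp [add_comm]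
  set W := fderiv ℝ (fderiv ℝ F) y u v +
    christoffel G (F y) (fderiv ℝ F y u) (fderiv ℝ F y v) with hW
  set A := fderiv ℝ F y with hA
  have hHy (x x' : E) : H y x x' = G (F y) (A x) (A x') := by rw [hH.self_of_nhds]; rfl
  -- Gauss formula: `W - A Γ_H(u,v)` is orthogonal to the image of `A`.
  have horth (w : E) : G (F y) (W - A (christoffel H y u v)) (A w) = 0 := by
    have h1 := map_christoffel hHi u v w
    rw [christoffelFirst_pullback hG hsymm hF hH, hHy, ← map_christoffel hGi] at h1
    simp only [map_sub, sub_apply, hW, map_add, add_apply]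
    rw [h1, add_comm, sub_self]
  have hWt : W = A (christoffel H y u v) - G (F y) t W • t := by
    obtain ⟨x, a, hx⟩ := hspan (W - A (christoffel H y u v))
    -- The tangential remainder `A x` is orthogonal to all tangent vectors, so `H x = 0`, and `H` is
    -- nondegenerate.
    have hxA : A x = 0 := by
      have h0 (w : E) : G (F y) (A x) (A w) = 0 := by
        have := horth w
        rw [hx] at this
        simpa [htF w] using this
      have h1 : H y x = 0 := by ext w; rw [hHy, h0]; rfl
      have : x = 0 := hHi.injective (by rw [h1, map_zero])
      rw [this, map_zero]
    rw [hxA, zero_add] at hx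
    have hWa : W = A (christoffel H y u v) + a • t := by rw [← hx]; abel
    have : G (F y) t W = -a := by rw [hWa]; simp [htF, ht]
    rw [this, neg_smul, sub_neg_eq_add]; exact hWa
  have hD : fderiv ℝ φ (F y) W =
      fderiv ℝ ψ y (christoffel H y u v) - G (F y) t W * fderiv ℝ φ (F y) t := by
    conv_lhs => rw [hWt]
    rw [hψ1.self_of_nhds]
    simp [hA]
  rw [coordHessian_apply, coordHessian_apply, hψ2]
  have : fderiv ℝ φ (F y) W = fderiv ℝ φ (F y) (fderiv ℝ (fderiv ℝ F) y u v) +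
      fderiv ℝ φ (F y) (christoffel G (F y) (A u) (A v)) := by rw [hW, map_add]
  linarith

end Coordinates

/-! ### Lorentzian forms, unit normals and traces. -/

section LinearAlgebra

variable {E E' : Type*} [NormedAddCommGroup E] [NormedSpace ℝ E]
  [NormedAddCommGroup E'] [NormedSpace ℝ E']

/-- Pairing with a vector of the diagonalising basis reads off the corresponding coordinate up to
sign. -/
theorem IsLorentzForm.nondegenerate {n : ℕ} {B : E →L[ℝ] E →L[ℝ] ℝ} (hB : IsLorentzForm n B)
    (v : E) (hv : ∀ w, B v w = 0) : v = 0 := by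
  obtain ⟨b, hb⟩ := hB
  refine b.repr.injective (Finsupp.ext fun j ↦ ?_)
  have := hv (b j)
  rw [← b.sum_repr v] at this
  simp only [map_sum, map_smul, sum_apply, smul_apply, hb,
    smul_eq_mul, mul_ite, mul_zero, Finset.sum_ite_eq', Finset.mem_univ, if_true] at this
  split_ifs at this <;> simpa using this

theorem IsLorentzForm.finrank_eq {n : ℕ} {B : E →L[ℝ] E →L[ℝ] ℝ} (hB : IsLorentzForm n B) :
    Module.finrank ℝ E = n + 1 := by
  obtain ⟨b, -⟩ := hB
  simpa using Module.finrank_eq_card_basis b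

theorem IsLorentzForm.exists_neg {n : ℕ} {B : E →L[ℝ] E →L[ℝ] ℝ} (hB : IsLorentzForm n B) :
    ∃ v, B v v < 0 := by
  obtain ⟨b, hb⟩ := hB
  exact ⟨b 0, by simp [hb]⟩

theorem traceWith_add (h B C : E →L[ℝ] E →L[ℝ] ℝ) :
    traceWith h (B + C) = traceWith h B + traceWith h C := by
  simp [traceWith, ContinuousLinearMap.comp_add]

theorem traceWith_smul (h B : E →L[ℝ] E →L[ℝ] ℝ) (a : ℝ) :
    traceWith h (a • B) = a * traceWith h B := by
  simp [traceWith]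

variable [FiniteDimensional ℝ E] [FiniteDimensional ℝ E']

/-- An injective map from `E` to its dual is bijective by dimension. This matters because
`ContinuousLinearMap.inverse`, used in `christoffel` and `traceWith`, is zero on non-invertible
maps. -/
theorem isInvertible_of_nondegenerate {B : E →L[ℝ] E →L[ℝ] ℝ}
    (hB : ∀ v, (∀ w, B v w = 0) → v = 0) : B.IsInvertible := by
  have hinj : Function.Injective (B : E →ₗ[ℝ] E →L[ℝ] ℝ) :=
    (injective_iff_map_eq_zero _).2 fun v hv ↦ hB v fun w ↦ by
      have := congrArg (fun L : E →L[ℝ] ℝ ↦ L w) hv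
      simpa using this
  have hdim : Module.finrank ℝ E = Module.finrank ℝ (E →L[ℝ] ℝ) := by
    rw [← (LinearMap.toContinuousLinearMap : (E →ₗ[ℝ] ℝ) ≃ₗ[ℝ] E →L[ℝ] ℝ).finrank_eq]
    exact (Subspace.dual_finrank_eq (K := ℝ) (V := E)).symm
  exact ⟨(LinearEquiv.ofInjectiveOfFinrankEq _ hinj hdim).toContinuousLinearEquiv, by ext; rfl⟩

/-- A hyperplane and a vector outside it span. -/
theorem exists_eq_map_add_smul {A : E →L[ℝ] E'} (hA : Function.Injective A)
    (hdim : Module.finrank ℝ E' = Module.finrank ℝ E + 1) {t : E'} (ht : t ∉ Set.range A)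
    (x : E') : ∃ u : E, ∃ a : ℝ, x = A u + a • t := by
  let L : E × ℝ →ₗ[ℝ] E' := (A : E →ₗ[ℝ] E').coprod (LinearMap.toSpanSingleton ℝ E' t)
  have hL : Function.Injective L := by
    refine (injective_iff_map_eq_zero _).2 fun ⟨u, a⟩ h ↦ ?_
    have h : A u + a • t = 0 := by simpa [L] using h
    have ha : a = 0 := by
      by_contra ha
      refine ht ⟨-a⁻¹ • u, ?_⟩
      rw [map_smul, eq_neg_of_add_eq_zero_left h, smul_neg, neg_smul, neg_neg, inv_smul_smul₀ ha]
    subst ha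
    have : u = 0 := hA (by simpa using h)
    simp [this]
  have hs : Function.Surjective L :=
    (LinearMap.injective_iff_surjective_of_finrank_eq_finrank (by simp [hdim])).1 hL
  obtain ⟨⟨u, a⟩, h⟩ := hs x
  exact ⟨u, a, by simpa [L] using h.symm⟩

/-- A spacelike hyperplane has a unit timelike normal. -/
theorem IsLorentzForm.exists_unit_normal {n : ℕ} {B : E' →L[ℝ] E' →L[ℝ] ℝ}
    (hB : IsLorentzForm n B) (hsymm : ∀ v w, B v w = B w v) {A : E →L[ℝ] E'}
    (hdim : Module.finrank ℝ E = n) (hA : ∀ u, u ≠ 0 → 0 < B (A u) (A u)) :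
    ∃ t, B t t = -1 ∧ ∀ u, B t (A u) = 0 := by
  have hinj : Function.Injective A := (injective_iff_map_eq_zero _).2 fun u hu ↦ by
    by_contra h
    simpa [hu] using hA u h
  -- The normals form the kernel of a map from dimension `n + 1` to dimension `n`, hence a nonzero
  -- space.
  let L : E' →ₗ[ℝ] Module.Dual ℝ E :=
    { toFun := fun t ↦ ((B t).comp A : E →L[ℝ] ℝ)
      map_add' := fun x y ↦ by ext; simp
      map_smul' := fun x y ↦ by ext; simp }
  have hker : LinearMap.ker L ≠ ⊥ := LinearMap.ker_ne_bot_of_finrank_lt (by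
    rw [Subspace.dual_finrank_eq, hdim, hB.finrank_eq]; omega)
  obtain ⟨t, htL, ht0⟩ := Submodule.exists_mem_ne_zero_of_ne_bot hker
  have hort (u : E) : B t (A u) = 0 := congrArg (fun l : Module.Dual ℝ E ↦ l u) htL
  have htr : t ∉ Set.range A := by
    rintro ⟨u, rfl⟩
    have hu : u ≠ 0 := by rintro rfl; simp at ht0
    exact (hA u hu).ne' (hort u)
  -- Otherwise `B` would be nonnegative on the tangent hyperplane and on `t`, which are orthogonal
  -- and span, contradicting the negative direction of `B`.
  have hneg : B t t < 0 := by
    by_contra! h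
    obtain ⟨x, hx⟩ := hB.exists_neg
    obtain ⟨u, a, rfl⟩ := exists_eq_map_add_smul hinj (by rw [hdim, hB.finrank_eq]) htr x
    have h1 : 0 ≤ B (A u) (A u) := by
      rcases eq_or_ne u 0 with rfl | hu
      · simp
      · exact (hA u hu).le
    have h2 : B (A u + a • t) (A u + a • t) = B (A u) (A u) + a * a * B t t := by
      simp [hort, hsymm (A u) t]; ring
    have := mul_nonneg (mul_self_nonneg a) h
    linarith
  have hpos : 0 < -B t t := by linarith
  refine ⟨(√(-B t t))⁻¹ • t, ?_, fun u ↦ by simp [hort]⟩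
  have hs := Real.mul_self_sqrt hpos.le
  have hs0 := (Real.sqrt_pos.2 hpos).ne'
  simp only [map_smul, smul_apply, smul_eq_mul]
  field_simp
  nlinarith

theorem isInvertible_of_posDef {h : E →L[ℝ] E →L[ℝ] ℝ} (hpos : ∀ u, u ≠ 0 → 0 < h u u) :
    h.IsInvertible :=
  isInvertible_of_nondegenerate fun v hv ↦ by
    by_contra hv0
    exact (hpos v hv0).ne' (hv v)

/-- In an `h`-orthogonal basis `b` the trace is the sum of `B (b i) (b i) / h (b i) (b i)`.
`Nontrivial E` makes the sum nonempty. -/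
theorem traceWith_pos [Nontrivial E] {h B : E →L[ℝ] E →L[ℝ] ℝ} (hsymm : ∀ v w, h v w = h w v)
    (hpos : ∀ u, u ≠ 0 → 0 < h u u) (hB : ∀ u, u ≠ 0 → 0 < B u u) : 0 < traceWith h B := by
  classical
  let β : LinearMap.BilinForm ℝ E := LinearMap.mk₂ ℝ (fun v w ↦ h v w) (by simp) (by simp)
    (by simp) (by simp)
  have hβ : LinearMap.IsSymm β := ⟨fun v w ↦ hsymm v w⟩
  obtain ⟨b, hb⟩ := LinearMap.BilinForm.exists_orthogonal_basis (B := β) hβ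
  have hb' (i j) (hij : i ≠ j) : h (b i) (b j) = 0 := hb hij
  have hrepr (v : E) (i) : b.repr v i = h v (b i) / h (b i) (b i) := by
    rw [eq_div_iff (hpos _ (b.ne_zero i)).ne']
    conv_rhs => rw [← b.sum_repr v]
    rw [map_sum, sum_apply, Finset.sum_eq_single i] <;> simp +contextual [hb']
  have hne : Nonempty (Fin (Module.finrank ℝ E)) := ⟨⟨0, Module.finrank_pos⟩⟩
  rw [traceWith, LinearMap.trace_eq_matrix_trace ℝ b, Matrix.trace]
  refine Finset.sum_pos (fun i _ ↦ ?_) Finset.univ_nonempty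
  have hbi := b.ne_zero i
  rw [Matrix.diag_apply, LinearMap.toMatrix_apply, hrepr]
  refine div_pos ?_ (hpos _ hbi)
  have := (isInvertible_of_posDef hpos).self_apply_inverse (B (b i))
  simpa [this] using hB _ hbi

end LinearAlgebra
-- Metrics in the preferred chart.
section

variable {E : Type*} [NormedAddCommGroup E] [NormedSpace ℝ E]
  {M : Type*} [TopologicalSpace M] [ChartedSpace E M] [IsManifold 𝓘(ℝ, E) ∞ M]

/-- Coordinate vector fields are smooth. -/
theorem contMDiffOn_mfderiv_extChartAt_symm (x : M) (u : E) :
    ContMDiffOn 𝓘(ℝ, E) (𝓘(ℝ, E).prod 𝓘(ℝ, E)) ∞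
      (fun y ↦ (⟨(extChartAt 𝓘(ℝ, E) x).symm y,
        mfderiv 𝓘(ℝ, E) 𝓘(ℝ, E) (extChartAt 𝓘(ℝ, E) x).symm y u⟩ : TangentBundle 𝓘(ℝ, E) M))
      (extChartAt 𝓘(ℝ, E) x).target := by
  have hop : IsOpen (extChartAt 𝓘(ℝ, E) x).target := isOpen_extChartAt_target x
  have h1 := (contMDiffOn_extChartAt_symm (I := 𝓘(ℝ, E)) (n := ∞) x).contMDiffOn_tangentMapWithin
    (m := ∞) (by simp) hop.uniqueMDiffOn
  -- The coordinate field is the tangent map of the inverse chart applied to a constant field on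
  -- `E`.
  have h2 : ContMDiff 𝓘(ℝ, E) (𝓘(ℝ, E).prod 𝓘(ℝ, E)) ∞
      (fun y : E ↦ (⟨y, u⟩ : TangentBundle 𝓘(ℝ, E) E)) := by
    intro y
    refine (Bundle.contMDiffAt_section (E := TangentSpace 𝓘(ℝ, E)) (s := fun _ ↦ u) y).2 ?_
    have h (z : E) : (trivializationAt E (TangentSpace 𝓘(ℝ, E)) y ⟨z, u⟩).2 = u := by
      rw [trivializationAt_model_space_apply]
    exact contMDiffAt_const.congr_of_eventuallyEq (.of_forall h)
  refine (h1.comp h2.contMDiffOn fun y hy ↦ hy).congr fun y hy ↦ ?_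
  simp only [Function.comp_apply, tangentMapWithin]
  rw [mfderivWithin_of_isOpen hop hy]

theorem mdifferentiableAt_extChartAt_symm {x : M} {y : E}
    (hy : y ∈ (extChartAt 𝓘(ℝ, E) x).target) :
    MDifferentiableAt 𝓘(ℝ, E) 𝓘(ℝ, E) (extChartAt 𝓘(ℝ, E) x).symm y := by
  have : IsManifold 𝓘(ℝ, E) 1 M := IsManifold.of_le (n := ∞) (by simp)
  have := mdifferentiableWithinAt_extChartAt_symm (I := 𝓘(ℝ, E)) hy
  rwa [modelWithCornersSelf_coe, Set.range_id, mdifferentiableWithinAt_univ] at this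

/-- Tangent vectors at `x` are identified with `E` through the preferred chart at `x`, so the
inverse chart has identity derivative at the base point. -/
theorem coordMetric_extChartAt_self
    (g : ∀ x : M, TangentSpace 𝓘(ℝ, E) x →L[ℝ] TangentSpace 𝓘(ℝ, E) x →L[ℝ] ℝ) (x : M) :
    coordMetric g x (extChartAt 𝓘(ℝ, E) x x) = g x := by
  have : IsManifold 𝓘(ℝ, E) 1 M := IsManifold.of_le (n := ∞) (by simp)
  have h1 : mfderiv 𝓘(ℝ, E) 𝓘(ℝ, E) (extChartAt 𝓘(ℝ, E) x).symm (extChartAt 𝓘(ℝ, E) x x) =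
      ContinuousLinearMap.id ℝ E := by
    have := mfderivWithin_range_extChartAt_symm (I := 𝓘(ℝ, E)) (x := x)
    rwa [modelWithCornersSelf_coe, Set.range_id, mfderivWithin_univ] at this
  have h2 (q : M) (hq : q = x) : (g q : E →L[ℝ] E →L[ℝ] ℝ) = g x := by subst hq; rfl
  ext u v
  have h3 : coordMetric g x (extChartAt 𝓘(ℝ, E) x x) u v =
    (g ((extChartAt 𝓘(ℝ, E) x).symm (extChartAt 𝓘(ℝ, E) x x)) : E →L[ℝ] E →L[ℝ] ℝ)
      ((mfderiv 𝓘(ℝ, E) 𝓘(ℝ, E) (extChartAt 𝓘(ℝ, E) x).symm (extChartAt 𝓘(ℝ, E) x x) :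
        E →L[ℝ] E) u)
      ((mfderiv 𝓘(ℝ, E) 𝓘(ℝ, E) (extChartAt 𝓘(ℝ, E) x).symm (extChartAt 𝓘(ℝ, E) x x) :
        E →L[ℝ] E) v) := rfl
  rw [h3, h1, h2 _ (extChartAt_to_inv x)]
  rfl

end

/-! ### Hypersurfaces in charts and the passage to the manifold. -/

section

variable {n : ℕ} {M : Type*} [TopologicalSpace M]
  [ChartedSpace (EuclideanSpace ℝ (Fin (n + 1))) M]
  {S : Type*} [TopologicalSpace S] [ChartedSpace (EuclideanSpace ℝ (Fin n)) S]

theorem contDiffAt_writtenInExtChartAt {ι : S → M} (hι : ContMDiff (𝓡 n) (𝓡 (n + 1)) ∞ ι)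
    (p : S) : ContDiffAt ℝ ∞ (writtenInExtChartAt (𝓡 n) (𝓡 (n + 1)) p ι)
      (extChartAt (𝓡 n) p p) := by
  have := (contMDiffAt_iff.1 (hι p)).2
  rwa [modelWithCornersSelf_coe, Set.range_id, contDiffWithinAt_univ] at this

theorem fderiv_writtenInExtChartAt {ι : S → M} (hι : ContMDiff (𝓡 n) (𝓡 (n + 1)) ∞ ι) (p : S) :
    fderiv ℝ (writtenInExtChartAt (𝓡 n) (𝓡 (n + 1)) p ι) (extChartAt (𝓡 n) p p) =
      mfderiv (𝓡 n) (𝓡 (n + 1)) ι p := by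
  have h := ((hι p).mdifferentiableAt (by simp)).mfderiv
  rw [modelWithCornersSelf_coe, Set.range_id, fderivWithin_univ] at h
  exact h.symm

/-- Near the base point both charts are used within their domains, so the coordinate expression
really represents `ι`. -/
theorem eventually_writtenInExtChartAt {ι : S → M} (hι : Continuous ι) (p : S) :
    ∀ᶠ y in 𝓝 (extChartAt (𝓡 n) p p), y ∈ (extChartAt (𝓡 n) p).target ∧
      ι ((extChartAt (𝓡 n) p).symm y) ∈ (extChartAt (𝓡 (n + 1)) (ι p)).source := by
  refine Filter.Eventually.and (extChartAt_target_mem_nhds (I := 𝓡 n) p) ?_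
  have h := (hι.continuousAt (x := p)).eventually (extChartAt_source_mem_nhds (I := 𝓡 (n + 1)) (ι p))
  have h' := continuousAt_extChartAt_symm (I := 𝓡 n) p
  rw [ContinuousAt, extChartAt_to_inv] at h'
  exact h'.eventually h

theorem extChartAt_symm_writtenInExtChartAt {ι : S → M} {p : S} {y : EuclideanSpace ℝ (Fin n)}
    (hy : ι ((extChartAt (𝓡 n) p).symm y) ∈ (extChartAt (𝓡 (n + 1)) (ι p)).source) :
    (extChartAt (𝓡 (n + 1)) (ι p)).symm (writtenInExtChartAt (𝓡 n) (𝓡 (n + 1)) p ι y) =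
      ι ((extChartAt (𝓡 n) p).symm y) :=
  (extChartAt (𝓡 (n + 1)) (ι p)).left_inv hy

variable [IsManifold (𝓡 (n + 1)) ∞ M]

/-- The components of a Lorentzian metric in a chart are smooth. -/
theorem contDiffOn_coordMetric (g : LorentzMetric n M) (x : M) :
    ContDiffOn ℝ ∞ (coordMetric g.form x) (extChartAt (𝓡 (n + 1)) x).target := by
  rw [contDiffOn_clm_apply]
  intro u
  rw [contDiffOn_clm_apply]
  intro v
  rw [← contMDiffOn_iff_contDiffOn]
  have hg := g.contMDiff.comp_contMDiffOn
    (contMDiffOn_extChartAt_symm (I := 𝓡 (n + 1)) (n := ∞) x)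
  have h := ContMDiffOn.clm_bundle_apply₂ (F₃ := ℝ) (E₃ := Bundle.Trivial M ℝ) hg
    (contMDiffOn_mfderiv_extChartAt_symm x u) (contMDiffOn_mfderiv_extChartAt_symm x v)
  intro y hy
  exact ((Bundle.contMDiffWithinAt_totalSpace).1 (h y hy)).2

theorem inducedMetric_symm (g : LorentzMetric n M) (ι : S → M) (p : S) (u v : TangentSpace (𝓡 n) p) :
    inducedMetric g ι p u v = inducedMetric g ι p v u :=
  g.symm (ι p) _ _

/-- The tangent space at a point of a spacelike hypersurface is spanned by the hyperplane tangent
to the hypersurface and a unit normal. -/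
theorem IsSpacelikeHypersurface.exists_eq_add_smul {g : LorentzMetric n M} {ι : S → M}
    (hι : IsSpacelikeHypersurface g ι) {p : S} {t : TangentSpace (𝓡 (n + 1)) (ι p)}
    (ht : IsUnitNormal g ι p t) (x : EuclideanSpace ℝ (Fin (n + 1))) :
    ∃ u : EuclideanSpace ℝ (Fin n), ∃ a : ℝ,
      x = (mfderiv (𝓡 n) (𝓡 (n + 1)) ι p : EuclideanSpace ℝ (Fin n) →L[ℝ]
        EuclideanSpace ℝ (Fin (n + 1))) u + a • t := by
  refine exists_eq_map_add_smul ((injective_iff_map_eq_zero _).2 fun u hu ↦ ?_) (by simp) ?_ x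
  · by_contra h
    refine (hι.spacelike p u h).ne' ?_
    change g.form (ι p) (mfderiv (𝓡 n) (𝓡 (n + 1)) ι p u) (mfderiv (𝓡 n) (𝓡 (n + 1)) ι p u) = 0
    have hu' : mfderiv (𝓡 n) (𝓡 (n + 1)) ι p u = 0 := hu
    rw [hu', map_zero]
  · rintro ⟨u, rfl⟩
    have h1 := ht.2 u
    have h2 := ht.1
    have : (0 : ℝ) = -1 := h1.symm.trans h2
    norm_num at this

variable [IsManifold (𝓡 n) ∞ S]

/-- The induced metric in coordinates is the pullback of the metric in coordinates. -/
theorem coordMetric_inducedMetric (g : LorentzMetric n M) {ι : S → M}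
    (hι : ContMDiff (𝓡 n) (𝓡 (n + 1)) ∞ ι) (p : S) :
    coordMetric (inducedMetric g ι) p =ᶠ[𝓝 (extChartAt (𝓡 n) p p)] fun z ↦
      (coordMetric g.form (ι p) (writtenInExtChartAt (𝓡 n) (𝓡 (n + 1)) p ι z)).bilinearComp
        (fderiv ℝ (writtenInExtChartAt (𝓡 n) (𝓡 (n + 1)) p ι) z)
        (fderiv ℝ (writtenInExtChartAt (𝓡 n) (𝓡 (n + 1)) p ι) z) := by
  have : IsManifold (𝓡 n) 1 S := IsManifold.of_le (n := ∞) (by simp)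
  have : IsManifold (𝓡 (n + 1)) 1 M := IsManifold.of_le (n := ∞) (by simp)
  set F := writtenInExtChartAt (𝓡 n) (𝓡 (n + 1)) p ι with hF
  filter_upwards [(eventually_writtenInExtChartAt hι.continuous p).eventually_nhds,
    ((contDiffAt_writtenInExtChartAt hι p).of_le (m := 1) (by simp)).eventually (by simp)]
    with y hy hFy
  obtain ⟨hyt, hys⟩ := hy.self_of_nhds
  have hFd : MDifferentiableAt (𝓡 n) (𝓡 (n + 1)) F y :=
    (hFy.differentiableAt (by simp)).mdifferentiableAt
  have hFt : F y ∈ (extChartAt (𝓡 (n + 1)) (ι p)).target :=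
    (extChartAt (𝓡 (n + 1)) (ι p)).map_source hys
  have hq : (extChartAt (𝓡 (n + 1)) (ι p)).symm (F y) = ι ((extChartAt (𝓡 n) p).symm y) :=
    extChartAt_symm_writtenInExtChartAt hys
  have hcomp : (extChartAt (𝓡 (n + 1)) (ι p)).symm ∘ F =ᶠ[𝓝 y] ι ∘ (extChartAt (𝓡 n) p).symm := by
    filter_upwards [hy] with z hz
    exact extChartAt_symm_writtenInExtChartAt hz.2
  -- The chain rule for the two factorisations of `ι ∘ chart⁻¹`, through `F` and directly, yields
  -- `hd`.
  have hd1 := mfderiv_comp y (mdifferentiableAt_extChartAt_symm hFt) hFd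
  have hd2 := mfderiv_comp y ((hι _).mdifferentiableAt (by simp)) (mdifferentiableAt_extChartAt_symm hyt)
  rw [hcomp.mfderiv_eq] at hd1
  have hd : ∀ u : EuclideanSpace ℝ (Fin n),
      (mfderiv (𝓡 (n + 1)) (𝓡 (n + 1)) (extChartAt (𝓡 (n + 1)) (ι p)).symm (F y) :
        EuclideanSpace ℝ (Fin (n + 1)) →L[ℝ] EuclideanSpace ℝ (Fin (n + 1))) (fderiv ℝ F y u) =
      (mfderiv (𝓡 n) (𝓡 (n + 1)) ι ((extChartAt (𝓡 n) p).symm y) :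
        EuclideanSpace ℝ (Fin n) →L[ℝ] EuclideanSpace ℝ (Fin (n + 1)))
      ((mfderiv (𝓡 n) (𝓡 n) (extChartAt (𝓡 n) p).symm y :
        EuclideanSpace ℝ (Fin n) →L[ℝ] EuclideanSpace ℝ (Fin n)) u) := by
    intro u
    rw [← mfderiv_eq_fderiv]
    exact congrArg (fun L : EuclideanSpace ℝ (Fin n) →L[ℝ] EuclideanSpace ℝ (Fin (n + 1)) ↦ L u)
      (hd1.symm.trans hd2)
  -- The two base points are only propositionally equal, so the forms are compared on the common
  -- model space.
  have hform (q q' : M) (h : q = q') : (g.form q : EuclideanSpace ℝ (Fin (n + 1)) →L[ℝ]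
      EuclideanSpace ℝ (Fin (n + 1)) →L[ℝ] ℝ) = g.form q' := by subst h; rfl
  ext u v
  have h1 : coordMetric g.form (ι p) (F y) (fderiv ℝ F y u) (fderiv ℝ F y v) =
    (g.form ((extChartAt (𝓡 (n + 1)) (ι p)).symm (F y)) : EuclideanSpace ℝ (Fin (n + 1)) →L[ℝ]
      EuclideanSpace ℝ (Fin (n + 1)) →L[ℝ] ℝ)
      ((mfderiv (𝓡 (n + 1)) (𝓡 (n + 1)) (extChartAt (𝓡 (n + 1)) (ι p)).symm (F y) :
        EuclideanSpace ℝ (Fin (n + 1)) →L[ℝ] EuclideanSpace ℝ (Fin (n + 1))) (fderiv ℝ F y u))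
      ((mfderiv (𝓡 (n + 1)) (𝓡 (n + 1)) (extChartAt (𝓡 (n + 1)) (ι p)).symm (F y) :
        EuclideanSpace ℝ (Fin (n + 1)) →L[ℝ] EuclideanSpace ℝ (Fin (n + 1))) (fderiv ℝ F y v)) := rfl
  rw [ContinuousLinearMap.bilinearComp_apply, h1, hd, hd, hform _ _ hq]
  rfl

/-- The Hessian of the restriction of a function to a spacelike hypersurface. -/
theorem IsSpacelikeHypersurface.hessian_eq {g : LorentzMetric n M} {ι : S → M}
    (hι : IsSpacelikeHypersurface g ι) {f : M → ℝ} (hf : ContMDiff (𝓡 (n + 1)) 𝓘(ℝ, ℝ) ∞ f)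
    {p : S} {t : TangentSpace (𝓡 (n + 1)) (ι p)} (ht : IsUnitNormal g ι p t)
    (u v : TangentSpace (𝓡 n) p) :
    hessian g.form f (ι p) (mfderiv (𝓡 n) (𝓡 (n + 1)) ι p u)
        (mfderiv (𝓡 n) (𝓡 (n + 1)) ι p v) =
      hessian (inducedMetric g ι) (f ∘ ι) p u v +
        secondFundamentalForm g ι p t u v * directionalDeriv f (ι p) t := by
  have h2 : (2 : WithTop ℕ∞) ≤ ∞ := WithTop.coe_le_coe.2 (le_top (a := (2 : ℕ∞)))
  have hs := hι.isSmoothEmbedding.contMDiff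
  have hFy : writtenInExtChartAt (𝓡 n) (𝓡 (n + 1)) p ι (extChartAt (𝓡 n) p p) =
      extChartAt (𝓡 (n + 1)) (ι p) (ι p) := by simp [writtenInExtChartAt]
  have hA := fderiv_writtenInExtChartAt hs p
  have hG0 := coordMetric_extChartAt_self g.form (ι p)
  have hH0 := coordMetric_extChartAt_self (inducedMetric g ι) p
  have hφ : ContDiffAt ℝ ∞ (f ∘ (extChartAt (𝓡 (n + 1)) (ι p)).symm)
      (extChartAt (𝓡 (n + 1)) (ι p) (ι p)) := by
    have := (contMDiffAt_iff.1 (hf (ι p))).2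
    rw [modelWithCornersSelf_coe, Set.range_id, contDiffWithinAt_univ] at this
    exact this
  have hGd : DifferentiableAt ℝ (coordMetric g.form (ι p))
      (extChartAt (𝓡 (n + 1)) (ι p) (ι p)) :=
    ((contDiffOn_coordMetric g (ι p)).contDiffAt
      (extChartAt_target_mem_nhds (ι p))).differentiableAt (by simp)
  have hψ : (f ∘ ι) ∘ (extChartAt (𝓡 n) p).symm =ᶠ[𝓝 (extChartAt (𝓡 n) p p)]
      (f ∘ (extChartAt (𝓡 (n + 1)) (ι p)).symm) ∘ writtenInExtChartAt (𝓡 n) (𝓡 (n + 1)) p ι := by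
    filter_upwards [eventually_writtenInExtChartAt hs.continuous p] with y hy
    simp only [Function.comp_apply]
    rw [extChartAt_symm_writtenInExtChartAt hy.2]
  have hdf : fderiv ℝ (f ∘ (extChartAt (𝓡 (n + 1)) (ι p)).symm)
      (extChartAt (𝓡 (n + 1)) (ι p) (ι p)) t = directionalDeriv f (ι p) t := by
    have h := ((hf (ι p)).mdifferentiableAt (by simp)).mfderiv
    rw [modelWithCornersSelf_coe, Set.range_id, fderivWithin_univ] at h
    exact congrArg (fun L : EuclideanSpace ℝ (Fin (n + 1)) →L[ℝ] ℝ ↦ L t) h.symm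
  have key := coordHessian_pullback (G := coordMetric g.form (ι p))
    (H := coordMetric (inducedMetric g ι) p)
    (F := writtenInExtChartAt (𝓡 n) (𝓡 (n + 1)) p ι)
    (φ := f ∘ (extChartAt (𝓡 (n + 1)) (ι p)).symm)
    (ψ := (f ∘ ι) ∘ (extChartAt (𝓡 n) p).symm) (y := extChartAt (𝓡 n) p p) (t := t)
    (by rwa [hFy]) (by rw [hFy, hG0]; exact g.symm (ι p))
    ((contDiffAt_writtenInExtChartAt hs p).of_le h2)
    (by rw [hFy]; exact hφ.of_le h2) hψ (coordMetric_inducedMetric g hs p)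
    (by rw [hFy, hG0]; exact isInvertible_of_nondegenerate (g.lorentzian (ι p)).nondegenerate)
    (by rw [hH0]; exact isInvertible_of_posDef (hι.spacelike p))
    (by rw [hFy, hG0]; exact ht.1) (by rw [hFy, hG0, hA]; exact ht.2)
    (by rw [hA]; exact hι.exists_eq_add_smul ht) u v
  rw [hFy, hA, hG0, hdf] at key
  exact key

/-- The restriction of a spacetime convex function to a maximal hypersurface is strictly
subharmonic. -/
theorem IsSpacetimeConvex.isStrictlySubharmonic (hn : 1 ≤ n) {g : LorentzMetric n M} {f : M → ℝ}
    (hf : IsSpacetimeConvex g f) {ι : S → M} (hι : IsSpacelikeHypersurface g ι)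
    (hmax : IsMaximal g ι) : IsStrictlySubharmonic (inducedMetric g ι) (f ∘ ι) := by
  refine ⟨hf.1.comp hι.isSmoothEmbedding.contMDiff, fun p ↦ ?_⟩
  obtain ⟨c, hc, hcg⟩ := hf.2.2
  have : Nonempty (Fin n) := ⟨⟨0, hn⟩⟩
  let A : EuclideanSpace ℝ (Fin n) →L[ℝ] EuclideanSpace ℝ (Fin (n + 1)) :=
    mfderiv (𝓡 n) (𝓡 (n + 1)) ι p
  obtain ⟨t, ht⟩ : ∃ t, IsUnitNormal g ι p t :=
    IsLorentzForm.exists_unit_normal (E := EuclideanSpace ℝ (Fin n))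
      (E' := EuclideanSpace ℝ (Fin (n + 1))) (A := A) (g.lorentzian (ι p)) (g.symm (ι p)) (by simp)
      (hι.spacelike p)
  let h : EuclideanSpace ℝ (Fin n) →L[ℝ] EuclideanSpace ℝ (Fin n) →L[ℝ] ℝ := inducedMetric g ι p
  let Q : EuclideanSpace ℝ (Fin n) →L[ℝ] EuclideanSpace ℝ (Fin n) →L[ℝ] ℝ :=
    hessian (inducedMetric g ι) (f ∘ ι) p
  let K : EuclideanSpace ℝ (Fin n) →L[ℝ] EuclideanSpace ℝ (Fin n) →L[ℝ] ℝ :=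
    secondFundamentalForm g ι p t
  have hK : traceWith h K = 0 := hmax p t ht
  -- Maximality allows the `K` term to be added without changing the trace; the resulting form is
  -- the ambient Hessian restricted to tangent vectors.
  have hQ : traceWith h (Q + directionalDeriv f (ι p) t • K) =
      laplacian (inducedMetric g ι) (f ∘ ι) p := by
    rw [traceWith_add, traceWith_smul, hK, mul_zero, add_zero]
    rfl
  rw [← hQ]
  refine traceWith_pos (inducedMetric_symm g ι p) (hι.spacelike p) fun u hu ↦ ?_
  have h1 : hessian g.form f (ι p) (A u) (A u) =
    Q u u + K u u * directionalDeriv f (ι p) t := hι.hessian_eq hf.1 ht u u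
  have h2 : c * h u u ≤ hessian g.form f (ι p) (A u) (A u) := hcg (ι p) (A u)
  have h3 : 0 < h u u := hι.spacelike p u hu
  have h4 : (Q + directionalDeriv f (ι p) t • K) u u =
    Q u u + directionalDeriv f (ι p) t * K u u := rfl
  rw [h4, mul_comm (directionalDeriv f (ι p) t), ← h1]
  exact (mul_pos hc h3).trans_le h2

end

end Spacetime

theorem mainTheorem9 {n : ℕ} (hn : 1 ≤ n)
    {M : Type*} [TopologicalSpace M] [ChartedSpace (EuclideanSpace ℝ (Fin (n + 1))) M]
    [IsManifold (𝓡 (n + 1)) ∞ M]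
    {S : Type*} [TopologicalSpace S] [ChartedSpace (EuclideanSpace ℝ (Fin n)) S]
    [IsManifold (𝓡 n) ∞ S]
    (g : LorentzMetric n M) (f : M → ℝ) (hf : IsSpacetimeConvex g f)
    (ι : S → M) (hι : IsSpacelikeHypersurface g ι) :
    (∀ (p : S) (t : TangentSpace (𝓡 (n + 1)) (ι p)), IsUnitNormal g ι p t →
      ∀ u v : TangentSpace (𝓡 n) p,
        hessian g.form f (ι p) (mfderiv (𝓡 n) (𝓡 (n + 1)) ι p u)
            (mfderiv (𝓡 n) (𝓡 (n + 1)) ι p v) =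
          hessian (inducedMetric g ι) (f ∘ ι) p u v +
            secondFundamentalForm g ι p t u v * directionalDeriv f (ι p) t) ∧
    (IsMaximal g ι → IsStrictlySubharmonic (inducedMetric g ι) (f ∘ ι)) := by
  exact ⟨fun p t ht u v ↦ hι.hessian_eq hf.1 ht u v, hf.isStrictlySubharmonic hn hι⟩
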